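/- Let $m\ge 1$. An $n$-dimensional space of $C^{n-1}$ functions on an interval $I$ is an EC-space on $I$ if each nonzero element has at most $n-1$ zeros in $I$, counted with multiplicity up to $n$. Let $a=x_0<x_1<\dots<x_q<x_{q+1}=b$, let $1\le\mu_i<m$ for $i=1,\dots,q$, put $K=\sum_{i=1}^q\mu_i$, and for $i=0,\dots,q$ let $\mathcal U_i$ be an $m$-dimensional EC-space on $[x_i,x_{i+1}]$ that contains the constants and for which $\{u' : u\in\mathcal U_i\}$ is an $(m-1)$-dimensional EC-space on $[x_i,x_{i+1}]$. The spline space $S$ consists of the functions $s$ on $[a,b]$ (extended by zero) for which there are $s_i\in\mathcal U_i$ with $s=s_i$ on $[x_i,x_{i+1}]$ for $i=0,\dots,q$, and $D^l s_{i-1}(x_i)=D^l s_i(x_i)$ for $0\le l\le m-\mu_i-1$ and $1\le i\le q$. Its extended partition is the nondecreasing sequence $t_1\le\dots\le t_{2m+K}$ in which $a$ and $b$ occur $m$ times each and $x_i$ occurs $\mu_i$ times. Put $\mu_i^R=\max\{j\ge0: t_{i+j}=t_i\}+1$ and $\mu_i^L=\max\{j\ge0: t_{i-j}=t_i\}+1$.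 A B-spline basis of $S$ is a sequence $N_1,\dots,N_{m+K}\in S$ such that $N_i=0$ outside $[t_i,t_{i+m}]$, $N_i>0$ on $(t_i,t_{i+m})$, $N_i$ vanishes exactly $m-\mu_i^R$ times at $t_i$ (from the right) and exactly $m-\mu_{i+m}^L$ times at $t_{i+m}$ (from the left), and $\sum_i N_i=1$ on $[a,b]$. The transition functions are $f_i=\sum_{j=i}^{m+K}N_j$. Let $\hat S$ be a second such spline space, of the same order $m$, whose extended partition $\hat t_1\le\dots\le\hat t_{2m+K+1}$ is obtained from $(t_i)$ by inserting one knot $\hat t$ with $t_\ell\le\hat t<t_{\ell+1}$; let $r$, with $1\le r<m$, be the multiplicity of $\hat t$ in $(\hat t_i)$. Suppose that $S\subset\hat S$ and that $S$ and $\hat S$ have B-spline bases $(N_i)_{i=1}^{m+K}$ and $(\hat N_i)_{i=1}^{m+K+1}$, with transition functions $f_i$ and $\hat f_i$. For $\ell-m+2\le i\le\ell-r+1$ put $$\alpha_i=\frac{D_+^{\,m-\mu_i^R}f_i(t_i)}{D_+^{\,m-\mu_i^R}\hat f_i(t_i)} ,$$ where $D_+$ denotes the right derivative; the denominator is nonzero.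 Let $s=\sum_{i=1}^{m+K}c_iN_i$ on $[a,b]$. Then $s$ has a unique representation $s=\sum_{i=1}^{m+K+1}\hat c_i\hat N_i$ on $[a,b]$, and its coefficients are $$\hat c_i=\begin{cases}c_i,& 1\le i\le\ell-m+1,\\ \alpha_ic_i+(1-\alpha_i)c_{i-1},&\ell-m+2\le i\le\ell-r+1,\\ c_{i-1},&\ell-r+2\le i\le m+K+1.\end{cases}$$ -/

import Mathlib

namespace PCSpline

noncomputable section

/-- `T` is an `n`-dimensional extended Chebyshev space on `I`: an `n`-dimensional space of functions
of class `C^(n-1)` on `I` such that a nonzero element has at most `n - 1` zeros in `I`, each zero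
being counted with multiplicity up to `n`.  The functions are written as functions on `ℝ`, but only
their values on `I` matter: an element that is zero on `I` has to be the zero function
(for infinite `I`). -/
def IsECSpace (n : ℕ) (I : Set ℝ) (T : Submodule ℝ (ℝ → ℝ)) : Prop :=
  Module.finrank ℝ T = n ∧
  (∀ u ∈ T, ContDiffOn ℝ ((n - 1 : ℕ) : WithTop ℕ∞) u I) ∧
  ∀ u ∈ T, u ≠ 0 → ∀ (Z : Finset ℝ) (κ : ℝ → ℕ), (Z : Set ℝ) ⊆ I →
    (∀ z ∈ Z, κ z ≤ n ∧ ∀ j < κ z, iteratedDerivWithin j u I z = 0) →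
    ∑ z ∈ Z, κ z < n

/-- The space `{u' | u ∈ T}` of derivatives on `I` (the image is already a linear space when the
elements of `T` are differentiable on `I`). -/
def derivSpace (I : Set ℝ) (T : Submodule ℝ (ℝ → ℝ)) : Submodule ℝ (ℝ → ℝ) :=
  Submodule.span ℝ ((fun u : ℝ → ℝ => derivWithin u I) '' (T : Set (ℝ → ℝ)))

/-- The data of a space of piecewise Chebyshevian splines of order `m`: points
`a = x 0 < x 1 < ⋯ < x q < x (q+1) = b`, multiplicities `μ 1, …, μ q`, and the section spaces
`T 0, …, T q`. Values at other indices are irrelevant. -/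
structure Data (m : ℕ) where
  q : ℕ
  x : ℕ → ℝ
  μ : ℕ → ℕ
  T : ℕ → Submodule ℝ (ℝ → ℝ)
  m_pos : 0 < m
  x_lt : ∀ i ≤ q, x i < x (i + 1)
  one_le_μ : ∀ i ∈ Finset.Icc 1 q, 1 ≤ μ i
  μ_lt : ∀ i ∈ Finset.Icc 1 q, μ i < m
  ec : ∀ i ≤ q, IsECSpace m (Set.Icc (x i) (x (i + 1))) (T i)
  const_mem : ∀ i ≤ q, ∃ u ∈ T i, ∀ y ∈ Set.Icc (x i) (x (i + 1)), u y = 1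
  ec_deriv : ∀ i ≤ q, IsECSpace (m - 1) (Set.Icc (x i) (x (i + 1)))
    (derivSpace (Set.Icc (x i) (x (i + 1))) (T i))

namespace Data

variable {m : ℕ}

/-- The left end point of the domain. -/
def a (D : Data m) : ℝ := D.x 0

/-- The right end point of the domain. -/
def b (D : Data m) : ℝ := D.x (D.q + 1)

/-- `K = μ 1 + ⋯ + μ q`. -/
def K (D : Data m) : ℕ := ∑ i ∈ Finset.Icc 1 D.q, D.μ i

/-- The space of piecewise Chebyshevian splines. Splines are functions on `[a, b]`, written as
functions on `ℝ` that are extended by zero. -/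
def splineSpace (D : Data m) : Set (ℝ → ℝ) :=
  {s | (∀ y, y ∉ Set.Icc D.a D.b → s y = 0) ∧
    ∃ p : ℕ → ℝ → ℝ,
      (∀ i ≤ D.q, p i ∈ D.T i) ∧
      (∀ i ≤ D.q, ∀ y ∈ Set.Icc (D.x i) (D.x (i + 1)), s y = p i y) ∧
      ∀ i ∈ Finset.Icc 1 D.q, ∀ l < m - D.μ i,
        iteratedDerivWithin l (p (i - 1)) (Set.Icc (D.x (i - 1)) (D.x i)) (D.x i) =
          iteratedDerivWithin l (p i) (Set.Icc (D.x i) (D.x (i + 1))) (D.x i)}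

/-- `t 1 ≤ ⋯ ≤ t (2m+K)` is the extended partition of the spline space, without external knots:
the end points `a` and `b` are repeated `m` times, and `t (m+1), …, t (m+K)` are the break-points
repeated according to their multiplicities. -/
def IsExtendedPartition (D : Data m) (t : ℕ → ℝ) : Prop :=
  (∀ i ∈ Finset.Icc 1 (2 * m + D.K), ∀ j ∈ Finset.Icc 1 (2 * m + D.K), i ≤ j → t i ≤ t j) ∧
  (∀ i ∈ Finset.Icc 1 m, t i = D.a) ∧
  (∀ i ∈ Finset.Icc (m + D.K + 1) (2 * m + D.K), t i = D.b) ∧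
  Multiset.map t (Finset.Icc (m + 1) (m + D.K)).val =
    ∑ j ∈ Finset.Icc 1 D.q, Multiset.replicate (D.μ j) (D.x j)

/-- `μ_i^R = max {j ≥ 0 | t_i = t_{i+j}} + 1`. -/
def muR (D : Data m) (t : ℕ → ℝ) (i : ℕ) : ℕ :=
  sSup {j : ℕ | i + j ≤ 2 * m + D.K ∧ t i = t (i + j)} + 1

/-- `μ_i^L = max {j ≥ 0 | t_{i-j} = t_i} + 1`. -/
def muL (_D : Data m) (t : ℕ → ℝ) (i : ℕ) : ℕ :=
  sSup {j : ℕ | j < i ∧ t (i - j) = t i} + 1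

end Data

/-- The right derivative `D_+^k f (y)`. -/
def rightDeriv (k : ℕ) (f : ℝ → ℝ) (y : ℝ) : ℝ := iteratedDerivWithin k f (Set.Ici y) y

/-- The left derivative `D_-^k f (y)`. -/
def leftDeriv (k : ℕ) (f : ℝ → ℝ) (y : ℝ) : ℝ := iteratedDerivWithin k f (Set.Iic y) y

namespace Data

variable {m : ℕ}

/-- `N 1, …, N (m+K)` is the B-spline basis of the spline space with extended partition `t`. -/
structure IsBSplineBasis (D : Data m) (t : ℕ → ℝ) (N : ℕ → ℝ → ℝ) : Prop where
  mem : ∀ i ∈ Finset.Icc 1 (m + D.K), N i ∈ D.splineSpace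
  support : ∀ i ∈ Finset.Icc 1 (m + D.K), ∀ y, y ∉ Set.Icc (t i) (t (i + m)) → N i y = 0
  pos : ∀ i ∈ Finset.Icc 1 (m + D.K), ∀ y ∈ Set.Ioo (t i) (t (i + m)), 0 < N i y
  left_end : ∀ i ∈ Finset.Icc 1 (m + D.K),
    (∀ j < m - D.muR t i, rightDeriv j (N i) (t i) = 0) ∧
      rightDeriv (m - D.muR t i) (N i) (t i) ≠ 0
  right_end : ∀ i ∈ Finset.Icc 1 (m + D.K),
    (∀ j < m - D.muL t (i + m), leftDeriv j (N i) (t (i + m)) = 0) ∧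
      leftDeriv (m - D.muL t (i + m)) (N i) (t (i + m)) ≠ 0
  sum_eq_one : ∀ y ∈ Set.Icc D.a D.b, ∑ i ∈ Finset.Icc 1 (m + D.K), N i y = 1

/-- The transition function `f_i = N_i + N_{i+1} + ⋯ + N_{m+K}`. -/
def transition (D : Data m) (N : ℕ → ℝ → ℝ) (i : ℕ) : ℝ → ℝ :=
  fun y => ∑ j ∈ Finset.Icc i (m + D.K), N j y

/-- The knots `t'` (`2m+K+1` of them, the extended partition of `D'`) arise from the knots `t` of
`D` by inserting `τ` with `t_ℓ ≤ τ < t_{ℓ+1}`. -/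
structure IsKnotInsertion (D D' : Data m) (t t' : ℕ → ℝ) (ℓ : ℕ) (τ : ℝ) : Prop where
  part : D.IsExtendedPartition t
  part' : D'.IsExtendedPartition t'
  card_eq : D'.K = D.K + 1
  one_le : 1 ≤ ℓ
  lt_card : ℓ + 1 ≤ 2 * m + D.K
  le_τ : t ℓ ≤ τ
  τ_lt : τ < t (ℓ + 1)
  before : ∀ i ∈ Finset.Icc 1 ℓ, t' i = t i
  at_τ : t' (ℓ + 1) = τ
  after : ∀ i ∈ Finset.Icc (ℓ + 1) (2 * m + D.K), t' (i + 1) = t i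

/-- The multiplicity of `τ` among the knots `t 1, …, t (2m+K)`. -/
def knotMult (D : Data m) (t : ℕ → ℝ) (τ : ℝ) : ℕ :=
  Multiset.count τ (Multiset.map t (Finset.Icc 1 (2 * m + D.K)).val)

/-- The ratio `D_+^{k+1} f_i (t_i) / D_+^{k+1} f̂_i (t_i)`, where `k + 1 = m - μ_i^R` is formed with
the original knots and `f_i`, `f̂_i` are the transition functions of `D` and `D'`. -/
def alpha (D D' : Data m) (t : ℕ → ℝ) (N N' : ℕ → ℝ → ℝ) (i : ℕ) : ℝ :=
  rightDeriv (m - D.muR t i) (D.transition N i) (t i) /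
    rightDeriv (m - D.muR t i) (D'.transition N' i) (t i)

end Data

end

end PCSpline

/-! ### One-sided derivatives of splines and the dimension bound. -/

namespace PCSpline

open Set Filter Topology

/-! Everything rests on triangularity at the knots. At `t j`, in the right derivative of order `m -
muR t j`, the B-spline `N j` is nonzero while every later one vanishes: its support starts further
right, or it starts at the same knot with higher order. Left derivatives at `t (j + m)` behave
symmetrically. So coefficients can be read off one after another from either end
(`coeff_eq_zero_of_rightDeriv`, `coeff_eq_zero_of_leftDeriv`), and the B-splines are independent.
The EC property bounds the dimension of the spline space by `m + K`, so they also span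
(`exists_coeff`).

Since the spaces are nested, each old `N i` is a combination of new B-splines with coefficients `G i
j`. Comparing orders of vanishing at the two ends of its support leaves only `j = i` and `j = i +
1`, so the new coefficients are `c j * G j j + c (j - 1) * G (j - 1) j`. The two partitions of unity
give `G j j + G (j - 1) j = 1`. Far left of the new knot `G (j - 1) j = 0`, from the new knot on `G
j j = 0`, and in between the ratio of leading derivatives of the transition functions is `G j j`. -/

theorem iteratedDerivWithin_sum_mul {I : Set ℝ} (hI : UniqueDiffOn ℝ I) {y : ℝ} (hy : y ∈ I)
    {k : ℕ} (A : Finset ℕ) (c : ℕ → ℝ) (F : ℕ → ℝ → ℝ)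
    (hF : ∀ i ∈ A, ContDiffWithinAt ℝ k (F i) I y) :
    iteratedDerivWithin k (fun z => ∑ i ∈ A, c i * F i z) I y =
      ∑ i ∈ A, c i * iteratedDerivWithin k (F i) I y := by
  rw [iteratedDerivWithin_fun_sum hy hI fun i hi => contDiffWithinAt_const.mul (hF i hi)]
  simp

theorem IsECSpace.eq_zero_of_iteratedDerivWithin_eq_zero {n : ℕ} {I : Set ℝ}
    {T : Submodule ℝ (ℝ → ℝ)} (hT : IsECSpace n I T) {u : ℝ → ℝ} (hu : u ∈ T) {z : ℝ}
    (hz : z ∈ I) (h : ∀ j < n, iteratedDerivWithin j u I z = 0) : u = 0 := by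
  by_contra h0
  have := hT.2.2 u hu h0 {z} (fun _ => n) (by simpa using hz) (by simpa using h)
  simp at this

namespace Data

variable {m : ℕ} (D : Data m)

theorem x_strictMonoOn : StrictMonoOn D.x (Icc 0 (D.q + 1)) := by
  apply strictMonoOn_of_lt_add_one ordConnected_Icc
  intro i _ _ hi
  exact D.x_lt i (by have := hi.2; omega)

theorem a_lt_b : D.a < D.b :=
  D.x_strictMonoOn (by simp) (by simp) (Nat.succ_pos _)

theorem x_mem_Icc {i : ℕ} (hi : i ≤ D.q + 1) : D.x i ∈ Icc D.a D.b :=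
  ⟨D.x_strictMonoOn.monotoneOn (by simp) (by simpa using hi) (Nat.zero_le _),
    D.x_strictMonoOn.monotoneOn (by simpa using hi) (by simp) hi⟩

theorem exists_mem_Ico {y : ℝ} (hy : y ∈ Ico D.a D.b) :
    ∃ i ≤ D.q, D.x i ≤ y ∧ y < D.x (i + 1) := by
  by_contra! h
  have : ∀ i ≤ D.q + 1, D.x i ≤ y := by
    intro i
    induction i with
    | zero => exact fun _ => hy.1
    | succ i ih => exact fun hi => h i (by omega) (ih (by omega))
  exact (this _ le_rfl).not_gt hy.2

theorem exists_mem_Ioc {y : ℝ} (hy : y ∈ Ioc D.a D.b) :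
    ∃ i ≤ D.q, D.x i < y ∧ y ≤ D.x (i + 1) := by
  by_contra! h
  have : ∀ i ≤ D.q + 1, D.x i < y := by
    intro i
    induction i with
    | zero => exact fun _ => hy.1
    | succ i ih => exact fun hi => h i (by omega) (ih (by omega))
  exact (this _ le_rfl).not_ge hy.2

variable {D}

/-- Just to the right of `y` a spline is a single section function, so its one-sided smoothness is
`m - 1` even at break-points. -/
theorem contDiffWithinAt_Ici {s : ℝ → ℝ} (hs : s ∈ D.splineSpace) {y : ℝ}
    (hy : y ∈ Ico D.a D.b) : ContDiffWithinAt ℝ ((m - 1 : ℕ) : WithTop ℕ∞) s (Ici y) y := by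
  obtain ⟨-, p, hp, hsp, -⟩ := hs
  obtain ⟨i, hi, h1, h2⟩ := D.exists_mem_Ico hy
  have h := ((D.ec i hi).2.1 (p i) (hp i hi)).congr (hsp i hi) y ⟨h1, h2.le⟩
  refine h.mono_of_mem_nhdsWithin ?_
  exact mem_of_superset (Icc_mem_nhdsGE h2) (Icc_subset_Icc_left h1)

theorem contDiffWithinAt_Iic {s : ℝ → ℝ} (hs : s ∈ D.splineSpace) {y : ℝ}
    (hy : y ∈ Ioc D.a D.b) : ContDiffWithinAt ℝ ((m - 1 : ℕ) : WithTop ℕ∞) s (Iic y) y := by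
  obtain ⟨-, p, hp, hsp, -⟩ := hs
  obtain ⟨i, hi, h1, h2⟩ := D.exists_mem_Ioc hy
  have h := ((D.ec i hi).2.1 (p i) (hp i hi)).congr (hsp i hi) y ⟨h1.le, h2⟩
  refine h.mono_of_mem_nhdsWithin ?_
  exact mem_of_superset (Icc_mem_nhdsLE h1) (Icc_subset_Icc_right h2)

theorem rightDeriv_sum_mul {k : ℕ} (hk : k < m) {y : ℝ} (hy : y ∈ Ico D.a D.b)
    (A : Finset ℕ) (c : ℕ → ℝ) (F : ℕ → ℝ → ℝ) (hF : ∀ i ∈ A, F i ∈ D.splineSpace) :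
    rightDeriv k (fun z => ∑ i ∈ A, c i * F i z) y = ∑ i ∈ A, c i * rightDeriv k (F i) y :=
  iteratedDerivWithin_sum_mul (uniqueDiffOn_Ici y) self_mem_Ici A c F fun i hi =>
    (contDiffWithinAt_Ici (hF i hi) hy).of_le (by exact_mod_cast (by omega : k ≤ m - 1))

theorem leftDeriv_sum_mul {k : ℕ} (hk : k < m) {y : ℝ} (hy : y ∈ Ioc D.a D.b)
    (A : Finset ℕ) (c : ℕ → ℝ) (F : ℕ → ℝ → ℝ) (hF : ∀ i ∈ A, F i ∈ D.splineSpace) :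
    leftDeriv k (fun z => ∑ i ∈ A, c i * F i z) y = ∑ i ∈ A, c i * leftDeriv k (F i) y :=
  iteratedDerivWithin_sum_mul (uniqueDiffOn_Iic y) self_mem_Iic A c F fun i hi =>
    (contDiffWithinAt_Iic (hF i hi) hy).of_le (by exact_mod_cast (by omega : k ≤ m - 1))

end Data

theorem rightDeriv_eq_zero_of_eqOn {f : ℝ → ℝ} {y z : ℝ} (hyz : y < z)
    (h : ∀ w, y ≤ w → w < z → f w = 0) (k : ℕ) : rightDeriv k f y = 0 := by
  have : f =ᶠ[𝓝[Ici y] y] fun _ => 0 := by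
    filter_upwards [Ico_mem_nhdsGE hyz] with w hw using h w hw.1 hw.2
  rw [rightDeriv, this.iteratedDerivWithin_eq (h y le_rfl hyz)]
  simp

theorem leftDeriv_eq_zero_of_eqOn {f : ℝ → ℝ} {y z : ℝ} (hyz : z < y)
    (h : ∀ w, z < w → w ≤ y → f w = 0) (k : ℕ) : leftDeriv k f y = 0 := by
  have : f =ᶠ[𝓝[Iic y] y] fun _ => 0 := by
    filter_upwards [Ioc_mem_nhdsLE hyz] with w hw using h w hw.1 hw.2
  rw [leftDeriv, this.iteratedDerivWithin_eq (h y hyz le_rfl)]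
  simp

theorem rightDeriv_eq_iteratedDerivWithin_Icc {f p : ℝ → ℝ} {y z : ℝ} (hyz : y < z)
    (h : ∀ w ∈ Icc y z, f w = p w) (k : ℕ) :
    rightDeriv k f y = iteratedDerivWithin k p (Icc y z) y := by
  have hset : (Ici y : Set ℝ) =ᶠ[𝓝 y] Icc y z := by
    filter_upwards [Iio_mem_nhds hyz] with w hw
    exact propext ⟨fun h => ⟨h, le_of_lt hw⟩, fun h => h.1⟩
  rw [← iteratedDerivWithin_congr (fun w hw => h w hw) (left_mem_Icc.2 hyz.le), rightDeriv,
    iteratedDerivWithin, iteratedDerivWithin, iteratedFDerivWithin_congr_set hset]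

namespace Data

variable {m : ℕ} (D : Data m)

/-- The spline space as a linear space. -/
def splineSubmodule : Submodule ℝ (ℝ → ℝ) where
  carrier := D.splineSpace
  zero_mem' := ⟨fun _ _ => rfl, fun _ => 0, fun _ _ => Submodule.zero_mem _,
    fun _ _ _ _ => rfl, fun _ _ _ _ => by simp⟩
  add_mem' := by
    rintro s s' ⟨h0, p, hp, hsp, hD⟩ ⟨h0', p', hp', hsp', hD'⟩
    refine ⟨fun y hy => by simp [h0 y hy, h0' y hy], fun i => p i + p' i,
      fun i hi => Submodule.add_mem _ (hp i hi) (hp' i hi),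
      fun i hi y hy => by simp [hsp i hi y hy, hsp' i hi y hy], fun i hi l hl => ?_⟩
    have hi' := Finset.mem_Icc.1 hi
    have key : ∀ j ≤ D.q, ∀ z ∈ Icc (D.x j) (D.x (j + 1)),
        iteratedDerivWithin l (p j + p' j) (Icc (D.x j) (D.x (j + 1))) z =
          iteratedDerivWithin l (p j) (Icc (D.x j) (D.x (j + 1))) z +
          iteratedDerivWithin l (p' j) (Icc (D.x j) (D.x (j + 1))) z := by
      intro j hj z hz
      have hl' : ((l : ℕ) : WithTop ℕ∞) ≤ ((m - 1 : ℕ) : WithTop ℕ∞) := by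
        exact_mod_cast (by omega : l ≤ m - 1)
      exact iteratedDerivWithin_add hz (uniqueDiffOn_Icc (D.x_lt j hj))
        (((D.ec j hj).2.1 _ (hp j hj) z hz).of_le hl')
        (((D.ec j hj).2.1 _ (hp' j hj) z hz).of_le hl')
    obtain ⟨j, rfl⟩ : ∃ j, i = j + 1 := ⟨i - 1, by omega⟩
    have e1 := hD _ hi l hl
    have e2 := hD' _ hi l hl
    simp only [Nat.add_sub_cancel] at e1 e2 ⊢
    rw [key j (by omega) _ (right_mem_Icc.2 (D.x_lt j (by omega)).le),
      key (j + 1) (by omega) _ (left_mem_Icc.2 (D.x_lt (j + 1) (by omega)).le), e1, e2]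
  smul_mem' := by
    rintro c s ⟨h0, p, hp, hsp, hD⟩
    refine ⟨fun y hy => by simp [h0 y hy], fun i => c • p i,
      fun i hi => Submodule.smul_mem _ _ (hp i hi),
      fun i hi y hy => by simp [hsp i hi y hy], fun i hi l hl => ?_⟩
    simp only [iteratedDerivWithin_const_smul_field, hD i hi l hl]

variable {D}

/-- Sections vanish one by one from the left: at `D.x k` the orders below `m - μ k` are inherited
from the preceding zero section and the others are assumed. A nonzero element of an EC-space has no
zero of order `m`. -/
theorem eq_zero_of_rightDeriv_eq_zero {s : ℝ → ℝ} (hs : s ∈ D.splineSpace)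
    (ha : ∀ l < m, rightDeriv l s D.a = 0)
    (hx : ∀ k ∈ Finset.Icc 1 D.q, ∀ l < m, m - D.μ k ≤ l → rightDeriv l s (D.x k) = 0) :
    s = 0 := by
  obtain ⟨h0, p, hp, hsp, hD⟩ := hs
  have hder : ∀ k ≤ D.q, ∀ l, rightDeriv l s (D.x k) =
      iteratedDerivWithin l (p k) (Icc (D.x k) (D.x (k + 1))) (D.x k) := fun k hk l =>
    rightDeriv_eq_iteratedDerivWithin_Icc (D.x_lt k hk) (hsp k hk) l
  have hpz : ∀ k ≤ D.q, p k = 0 := by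
    intro k
    induction k with
    | zero =>
      intro hk
      refine (D.ec 0 hk).eq_zero_of_iteratedDerivWithin_eq_zero (hp 0 hk)
        (left_mem_Icc.2 (D.x_lt 0 hk).le) fun j hj => ?_
      rw [← hder 0 hk]
      exact ha j hj
    | succ k ih =>
      intro hk
      refine (D.ec _ hk).eq_zero_of_iteratedDerivWithin_eq_zero (hp _ hk)
        (left_mem_Icc.2 (D.x_lt _ hk).le) fun j hj => ?_
      have hk1 : k + 1 ∈ Finset.Icc 1 D.q := by simp; omega
      rcases lt_or_ge j (m - D.μ (k + 1)) with h | h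
      · rw [← hD _ hk1 j h, Nat.add_sub_cancel, ih (by omega)]
        simp
      · rw [← hder _ hk]
        exact hx _ hk1 j hj h
  funext y
  by_cases hy : y ∈ Icc D.a D.b
  · rcases eq_or_lt_of_le hy.2 with h | h
    · rw [h, Data.b, hsp D.q le_rfl _ (right_mem_Icc.2 (D.x_lt _ le_rfl).le), hpz _ le_rfl]
    · obtain ⟨i, hi, h1, h2⟩ := D.exists_mem_Ico ⟨hy.1, h⟩
      rw [hsp i hi y ⟨h1, h2.le⟩, hpz i hi]
  · exact h0 y hy

theorem rightDeriv_add {k : ℕ} (hk : k < m) {y : ℝ} (hy : y ∈ Ico D.a D.b) {s s' : ℝ → ℝ}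
    (hs : s ∈ D.splineSpace) (hs' : s' ∈ D.splineSpace) :
    rightDeriv k (s + s') y = rightDeriv k s y + rightDeriv k s' y :=
  have hk' : (k : WithTop ℕ∞) ≤ ((m - 1 : ℕ) : WithTop ℕ∞) := by
    exact_mod_cast (by omega : k ≤ m - 1)
  iteratedDerivWithin_add self_mem_Ici (uniqueDiffOn_Ici y)
    ((contDiffWithinAt_Ici hs hy).of_le hk') ((contDiffWithinAt_Ici hs' hy).of_le hk')

variable (D)

/-- The pairs of a derivative order and a point of the domain that determine a spline: all orders
less than `m` at `a`, and at a break-point the orders that may have a jump. -/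
def jumpData : Fin m ⊕ (Σ k : Finset.Icc 1 D.q, Fin (D.μ k)) → ℕ × ℝ
  | .inl l => (l, D.a)
  | .inr ⟨k, l⟩ => (m - D.μ k + l, D.x k)

theorem jumpData_fst_lt (j) : (D.jumpData j).1 < m := by
  rcases j with l | ⟨k, l⟩
  · exact l.2
  · have := D.μ_lt k k.2
    have := l.2
    simp only [jumpData]
    omega

theorem jumpData_snd_mem (j) : (D.jumpData j).2 ∈ Ico D.a D.b := by
  rcases j with l | ⟨k, l⟩
  · exact ⟨le_rfl, D.a_lt_b⟩
  · have h := Finset.mem_Icc.1 k.2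
    refine ⟨(D.x_mem_Icc (by omega)).1, ?_⟩
    exact D.x_strictMonoOn (by simp; omega) (by simp) (by omega)

/-- The one-sided derivatives that determine a spline. -/
noncomputable def jumpMap : D.splineSubmodule →ₗ[ℝ]
    (Fin m ⊕ (Σ k : Finset.Icc 1 D.q, Fin (D.μ k)) → ℝ) where
  toFun s j := rightDeriv (D.jumpData j).1 s (D.jumpData j).2
  map_add' s s' := by
    funext j
    exact rightDeriv_add (D.jumpData_fst_lt j) (D.jumpData_snd_mem j) s.2 s'.2
  map_smul' c s := by
    funext j
    simp [rightDeriv]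

theorem jumpMap_injective : Function.Injective D.jumpMap := by
  rw [injective_iff_map_eq_zero]
  intro s hs
  refine Subtype.ext (eq_zero_of_rightDeriv_eq_zero s.2 (fun l hl => ?_) fun k hk l hl hml => ?_)
  · exact congr_fun hs (.inl ⟨l, hl⟩)
  · have h := congr_fun hs (.inr ⟨⟨k, hk⟩, ⟨l - (m - D.μ k), by
      have := D.μ_lt k hk
      show _ < D.μ k
      omega⟩⟩)
    have e : m - D.μ k + (l - (m - D.μ k)) = l := by omega
    simpa [jumpMap, jumpData, e] using h

instance finiteDimensional_splineSubmodule : FiniteDimensional ℝ D.splineSubmodule :=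
  Module.Finite.of_injective D.jumpMap D.jumpMap_injective

/-- The upper bound suffices: the reverse inequality comes from the independence of the B-splines.
-/
theorem finrank_splineSubmodule_le : Module.finrank ℝ D.splineSubmodule ≤ m + D.K := by
  refine (LinearMap.finrank_le_finrank_of_injective D.jumpMap_injective).trans_eq ?_
  rw [Module.finrank_pi, Fintype.card_sum, Fintype.card_sigma, K]
  simp only [Fintype.card_fin]
  rw [Finset.sum_coe_sort (Finset.Icc 1 D.q) D.μ]

end Data

end PCSpline

namespace PCSpline

open Set Filter Topology

namespace Data

variable {m : ℕ} {D : Data m} {t : ℕ → ℝ}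

/-! ### Multiplicities in an extended partition. -/

section Knots

theorem IsExtendedPartition.exists_eq_x (h : D.IsExtendedPartition t) {i : ℕ} (h1 : m + 1 ≤ i)
    (h2 : i ≤ m + D.K) : ∃ k ∈ Finset.Icc 1 D.q, t i = D.x k := by
  have : t i ∈ Multiset.map t (Finset.Icc (m + 1) (m + D.K)).val :=
    Multiset.mem_map_of_mem t (Finset.mem_Icc.2 ⟨h1, h2⟩)
  rw [h.2.2.2, Multiset.mem_sum] at this
  obtain ⟨k, hk, hik⟩ := this
  exact ⟨k, hk, Multiset.eq_of_mem_replicate hik⟩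

theorem IsExtendedPartition.mem_Ioo (h : D.IsExtendedPartition t) {i : ℕ} (h1 : m + 1 ≤ i)
    (h2 : i ≤ m + D.K) : t i ∈ Ioo D.a D.b := by
  obtain ⟨k, hk, e⟩ := h.exists_eq_x h1 h2
  have hk := Finset.mem_Icc.1 hk
  rw [e]
  exact ⟨D.x_strictMonoOn (by simp) (by simp; omega) (by omega),
    D.x_strictMonoOn (by simp; omega) (by simp) (by omega)⟩

theorem IsExtendedPartition.mem_Ico (h : D.IsExtendedPartition t) {i : ℕ} (h1 : 1 ≤ i)
    (h2 : i ≤ m + D.K) : t i ∈ Ico D.a D.b := by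
  rcases le_or_gt i m with him | him
  · rw [h.2.1 i (Finset.mem_Icc.2 ⟨h1, him⟩)]
    exact ⟨le_rfl, D.a_lt_b⟩
  · exact Ioo_subset_Ico_self (h.mem_Ioo him h2)

theorem IsExtendedPartition.mem_Ioc (h : D.IsExtendedPartition t) {i : ℕ} (h1 : m + 1 ≤ i)
    (h2 : i ≤ 2 * m + D.K) : t i ∈ Ioc D.a D.b := by
  rcases le_or_gt i (m + D.K) with him | him
  · exact Ioo_subset_Ioc_self (h.mem_Ioo h1 him)
  · rw [h.2.2.1 i (Finset.mem_Icc.2 ⟨him, h2⟩)]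
    exact ⟨D.a_lt_b, le_rfl⟩

theorem IsExtendedPartition.mono (h : D.IsExtendedPartition t) {i j : ℕ} (hi : 1 ≤ i)
    (hij : i ≤ j) (hj : j ≤ 2 * m + D.K) : t i ≤ t j :=
  h.1 i (Finset.mem_Icc.2 ⟨hi, hij.trans hj⟩) j (Finset.mem_Icc.2 ⟨hi.trans hij, hj⟩) hij

/-- Fewer than `m` interior knots coincide. -/
theorem IsExtendedPartition.count_lt (h : D.IsExtendedPartition t) {i : ℕ} (h1 : m + 1 ≤ i)
    (h2 : i ≤ m + D.K) :
    Multiset.count (t i) (Multiset.map t (Finset.Icc (m + 1) (m + D.K)).val) < m := by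
  obtain ⟨k, hk, e⟩ := h.exists_eq_x h1 h2
  rw [h.2.2.2, Multiset.count_sum', Finset.sum_eq_single k]
  · rw [e, Multiset.count_replicate_self]
    exact D.μ_lt k hk
  · intro j hj hjk
    rw [Multiset.count_replicate, if_neg]
    rw [e]
    intro hx
    have hk' := Finset.mem_Icc.1 hk
    have hj' := Finset.mem_Icc.1 hj
    exact hjk (D.x_strictMonoOn.injOn (by simp; omega) (by simp; omega) hx)
  · exact fun hk' => absurd hk hk'

theorem IsExtendedPartition.lt_add (h : D.IsExtendedPartition t) {i : ℕ} (h1 : 1 ≤ i)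
    (h2 : i ≤ m + D.K) : t i < t (i + m) := by
  rcases le_or_gt i m with him | him
  · rw [h.2.1 i (Finset.mem_Icc.2 ⟨h1, him⟩)]
    exact (h.mem_Ioc (by omega) (by omega)).1
  rcases le_or_gt (i + m) (m + D.K) with him' | him'
  · by_contra! hle
    refine (h.count_lt him h2).not_ge ?_
    rw [Multiset.count_map]
    have hsub : Finset.Icc i (i + m) ⊆ (Finset.Icc (m + 1) (m + D.K)).filter (t i = t ·) := by
      intro j hj
      rw [Finset.mem_Icc] at hj
      rw [Finset.mem_filter, Finset.mem_Icc]
      exact ⟨by omega, le_antisymm (h.mono h1 hj.1 (by omega))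
        ((h.mono (by omega) hj.2 (by omega)).trans hle)⟩
    have := Finset.card_le_card hsub
    rw [Nat.card_Icc] at this
    refine le_trans ?_ this
    omega
  · rw [h.2.2.1 (i + m) (Finset.mem_Icc.2 ⟨him', by omega⟩)]
    exact (h.mem_Ico h1 h2).2

/-- This and `exists_muR_eq` replace the supremum by the index `e` of an equal knot. The index set
is bounded, so the supremum is a genuine maximum rather than the default value `0`. -/
theorem le_muR {i e : ℕ} (hie : i ≤ e) (he : e ≤ 2 * m + D.K) (h : t e = t i) :
    e - i + 1 ≤ D.muR t i := by
  refine Nat.succ_le_succ (le_csSup ⟨2 * m + D.K, fun j hj => ?_⟩ ⟨by omega, ?_⟩)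
  · have := hj.1
    omega
  · rw [Nat.add_sub_cancel' hie, h]

theorem exists_muR_eq {i : ℕ} (hi : i ≤ 2 * m + D.K) :
    ∃ e, i ≤ e ∧ e ≤ 2 * m + D.K ∧ t e = t i ∧ D.muR t i = e - i + 1 := by
  have h := Nat.sSup_mem (s := {j : ℕ | i + j ≤ 2 * m + D.K ∧ t i = t (i + j)})
    ⟨0, by simpa using hi⟩ ⟨2 * m + D.K, fun j hj => by have := hj.1; omega⟩
  exact ⟨_, Nat.le_add_right _ _, h.1, h.2.symm, by rw [muR, Nat.add_sub_cancel_left]⟩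

theorem le_muL {i e : ℕ} (he : 1 ≤ e) (hie : e ≤ i) (h : t e = t i) :
    i - e + 1 ≤ D.muL t i := by
  refine Nat.succ_le_succ (le_csSup ⟨i, fun j hj => hj.1.le⟩ ⟨by omega, ?_⟩)
  rw [Nat.sub_sub_self hie, h]

theorem exists_muL_eq {i : ℕ} (hi : 1 ≤ i) :
    ∃ e, 1 ≤ e ∧ e ≤ i ∧ t e = t i ∧ D.muL t i = i - e + 1 := by
  have h := Nat.sSup_mem (s := {j : ℕ | j < i ∧ t (i - j) = t i})
    ⟨0, hi, rfl⟩ ⟨i, fun j hj => hj.1.le⟩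
  have h1 := h.1
  exact ⟨_, by omega, Nat.sub_le _ _, h.2, by rw [muL, Nat.sub_sub_self h1.le]⟩

theorem one_le_muR (i : ℕ) : 1 ≤ D.muR t i := Nat.le_add_left _ _

theorem one_le_muL (i : ℕ) : 1 ≤ D.muL t i := Nat.le_add_left _ _

/-- Ensures that `m - muR` is not truncated, so that strict inequalities between multiplicities
become strict inequalities between orders. -/
theorem IsExtendedPartition.muR_le (h : D.IsExtendedPartition t) {i : ℕ} (h1 : 1 ≤ i)
    (h2 : i ≤ m + D.K) : D.muR t i ≤ m := by
  obtain ⟨e, h3, h4, h5, h6⟩ := exists_muR_eq (D := D) (t := t) (i := i) (by omega)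
  by_contra! hm
  exact ((h.lt_add h1 h2).trans_le (h.mono (by omega) (by omega : i + m ≤ e) h4)).ne' h5

theorem IsExtendedPartition.muL_le (h : D.IsExtendedPartition t) {i : ℕ} (h1 : 1 ≤ i)
    (h2 : i ≤ m + D.K) : D.muL t (i + m) ≤ m := by
  obtain ⟨e, h3, h4, h5, h6⟩ := exists_muL_eq (D := D) (t := t) (i := i + m) (by omega)
  by_contra! hm
  exact ((h.mono h3 (by omega : e ≤ i) (by omega)).trans_lt (h.lt_add h1 h2)).ne h5

/-- Further along a run of equal knots fewer copies remain ahead, so the B-spline starting there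
vanishes to higher order. This is the source of triangularity. -/
theorem muR_lt_muR {i j : ℕ} (hji : j < i) (hi : i ≤ 2 * m + D.K) (h : t j = t i) :
    D.muR t i < D.muR t j := by
  obtain ⟨e, h3, h4, h5, h6⟩ := exists_muR_eq (D := D) (t := t) hi
  have := le_muR (D := D) (hji.le.trans h3) h4 (h5.trans h.symm)
  omega

theorem muL_lt_muL {i j : ℕ} (hi : 1 ≤ i) (hij : i < j) (h : t j = t i) :
    D.muL t i < D.muL t j := by
  obtain ⟨e, h3, h4, h5, h6⟩ := exists_muL_eq (D := D) (t := t) hi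
  have := le_muL (D := D) h3 (h4.trans hij.le) (h5.trans h.symm)
  omega

end Knots

/-! ### Triangularity, independence and spanning of the B-splines. -/

namespace IsBSplineBasis

variable {N : ℕ → ℝ → ℝ}

theorem rightDeriv_eq_zero (hN : D.IsBSplineBasis t N) {i : ℕ} (hi : i ∈ Finset.Icc 1 (m + D.K))
    {y : ℝ} (hy : y ≤ t i) {k : ℕ} (hk : y = t i → k < m - D.muR t i) :
    rightDeriv k (N i) y = 0 := by
  rcases eq_or_lt_of_le hy with h | h
  · rw [h]
    exact (hN.left_end i hi).1 k (hk h)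
  · exact rightDeriv_eq_zero_of_eqOn h
      (fun w _ hw => hN.support i hi w fun hw' => hw.not_ge hw'.1) k

theorem leftDeriv_eq_zero (hN : D.IsBSplineBasis t N) {i : ℕ} (hi : i ∈ Finset.Icc 1 (m + D.K))
    {y : ℝ} (hy : t (i + m) ≤ y) {k : ℕ} (hk : y = t (i + m) → k < m - D.muL t (i + m)) :
    leftDeriv k (N i) y = 0 := by
  rcases eq_or_lt_of_le hy with h | h
  · rw [← h]
    exact (hN.right_end i hi).1 k (hk h.symm)
  · exact leftDeriv_eq_zero_of_eqOn h
      (fun w hw _ => hN.support i hi w fun hw' => hw.not_ge hw'.2) k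

/-- The leading right derivative at a knot of a spline without B-splines of lower index. -/
theorem rightDeriv_sum (hN : D.IsBSplineBasis t N) (ht : D.IsExtendedPartition t)
    {A : Finset ℕ} (hA : A ⊆ Finset.Icc 1 (m + D.K)) {j : ℕ} (hj : j ∈ A) {c : ℕ → ℝ}
    (hc : ∀ i ∈ A, i < j → c i = 0) :
    rightDeriv (m - D.muR t j) (fun z => ∑ i ∈ A, c i * N i z) (t j) =
      c j * rightDeriv (m - D.muR t j) (N j) (t j) := by
  have hj' := Finset.mem_Icc.1 (hA hj)
  have hm := D.m_pos
  have h1 := one_le_muR (D := D) (t := t) j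
  rw [rightDeriv_sum_mul (D := D) (by omega) (ht.mem_Ico hj'.1 hj'.2) A c N
    fun i hi => hN.mem i (hA hi)]
  refine Finset.sum_eq_single j (fun i hi hij => ?_) fun h => absurd hj h
  rcases lt_or_gt_of_ne hij with h | h
  · rw [hc i hi h, zero_mul]
  · have hi' := Finset.mem_Icc.1 (hA hi)
    rw [hN.rightDeriv_eq_zero (hA hi) (ht.mono hj'.1 h.le (by omega)), mul_zero]
    intro e
    have := muR_lt_muR (D := D) h (by omega) e
    have := ht.muR_le hj'.1 hj'.2
    omega

/-- The leading left derivative at a knot of a spline without B-splines of higher index. -/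
theorem leftDeriv_sum (hN : D.IsBSplineBasis t N) (ht : D.IsExtendedPartition t)
    {A : Finset ℕ} (hA : A ⊆ Finset.Icc 1 (m + D.K)) {j : ℕ} (hj : j ∈ A) {c : ℕ → ℝ}
    (hc : ∀ i ∈ A, j < i → c i = 0) :
    leftDeriv (m - D.muL t (j + m)) (fun z => ∑ i ∈ A, c i * N i z) (t (j + m)) =
      c j * leftDeriv (m - D.muL t (j + m)) (N j) (t (j + m)) := by
  have hj' := Finset.mem_Icc.1 (hA hj)
  have hm := D.m_pos
  have h1 := one_le_muL (D := D) (t := t) (j + m)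
  rw [leftDeriv_sum_mul (D := D) (by omega) (ht.mem_Ioc (by omega) (by omega)) A c N
    fun i hi => hN.mem i (hA hi)]
  refine Finset.sum_eq_single j (fun i hi hij => ?_) fun h => absurd hj h
  rcases lt_or_gt_of_ne hij with h | h
  · have hi' := Finset.mem_Icc.1 (hA hi)
    rw [hN.leftDeriv_eq_zero (hA hi) (ht.mono (by omega) (by omega) (by omega)), mul_zero]
    intro e
    have := muL_lt_muL (D := D) (i := i + m) (by omega) (by omega) e
    have := ht.muL_le hj'.1 hj'.2
    omega
  · rw [hc i hi h, zero_mul]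

/-- Forward substitution: once the lower coefficients vanish, the leading derivative at `t j`
isolates `c j`. The cut-off `n` allows conclusions from the behaviour of `s` at the first knots
alone. -/
theorem coeff_eq_zero_of_rightDeriv (hN : D.IsBSplineBasis t N) (ht : D.IsExtendedPartition t)
    {s : ℝ → ℝ} {c : ℕ → ℝ} (hs : ∀ y, s y = ∑ i ∈ Finset.Icc 1 (m + D.K), c i * N i y) {n : ℕ}
    (h : ∀ j ∈ Finset.Icc 1 (m + D.K), j < n → rightDeriv (m - D.muR t j) s (t j) = 0) :
    ∀ j ∈ Finset.Icc 1 (m + D.K), j < n → c j = 0 := by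
  intro j
  induction j using Nat.strong_induction_on with
  | _ j ih =>
    intro hj hjn
    have h1 := h j hj hjn
    rw [funext hs, hN.rightDeriv_sum ht subset_rfl hj fun i hi hij => ih i hij hi (hij.trans hjn)]
      at h1
    exact (mul_eq_zero.1 h1).resolve_right (hN.left_end j hj).2

theorem coeff_eq_zero_of_leftDeriv (hN : D.IsBSplineBasis t N) (ht : D.IsExtendedPartition t)
    {s : ℝ → ℝ} {c : ℕ → ℝ} (hs : ∀ y, s y = ∑ i ∈ Finset.Icc 1 (m + D.K), c i * N i y) {n : ℕ}
    (h : ∀ j ∈ Finset.Icc 1 (m + D.K), n < j →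
      leftDeriv (m - D.muL t (j + m)) s (t (j + m)) = 0) :
    ∀ j ∈ Finset.Icc 1 (m + D.K), n < j → c j = 0 := by
  intro j
  -- Backward substitution, hence induction on the distance from the last index.
  induction hk : m + D.K - j using Nat.strong_induction_on generalizing j with
  | _ k ih =>
    intro hj hjn
    have h1 := h j hj hjn
    rw [funext hs, hN.leftDeriv_sum ht subset_rfl hj fun i hi hij =>
      ih (m + D.K - i) (by have := Finset.mem_Icc.1 hi; omega) i rfl hi (hjn.trans hij)] at h1
    exact (mul_eq_zero.1 h1).resolve_right (hN.right_end j hj).2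

theorem coeff_eq_zero (hN : D.IsBSplineBasis t N) (ht : D.IsExtendedPartition t) {c : ℕ → ℝ}
    (h : ∀ y, ∑ i ∈ Finset.Icc 1 (m + D.K), c i * N i y = 0) :
    ∀ j ∈ Finset.Icc 1 (m + D.K), c j = 0 := by
  intro j hj
  refine hN.coeff_eq_zero_of_rightDeriv ht (s := fun _ => 0) (n := j + 1)
    (fun y => (h y).symm) (fun i _ _ => ?_) j hj (Nat.lt_succ_self j)
  exact rightDeriv_eq_zero_of_eqOn (lt_add_one (t i)) (fun _ _ _ => rfl) _

theorem sum_eq_sum_iff (hN : D.IsBSplineBasis t N) (ht : D.IsExtendedPartition t)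
    {c d : ℕ → ℝ} :
    (∀ y ∈ Icc D.a D.b, ∑ i ∈ Finset.Icc 1 (m + D.K), c i * N i y =
      ∑ i ∈ Finset.Icc 1 (m + D.K), d i * N i y) ↔
      ∀ j ∈ Finset.Icc 1 (m + D.K), c j = d j := by
  refine ⟨fun h j hj => ?_, fun h y _ => Finset.sum_congr rfl fun i hi => by rw [h i hi]⟩
  refine sub_eq_zero.1 (hN.coeff_eq_zero ht (c := fun i => c i - d i) (fun y => ?_) j hj)
  by_cases hy : y ∈ Icc D.a D.b
  · simp only [sub_mul, Finset.sum_sub_distrib, h y hy, sub_self]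
  · exact Finset.sum_eq_zero fun i hi => by rw [(hN.mem i hi).1 y hy, mul_zero]

/-- The B-splines span the spline space. -/
theorem exists_coeff (hN : D.IsBSplineBasis t N) (ht : D.IsExtendedPartition t) {s : ℝ → ℝ}
    (hs : s ∈ D.splineSpace) :
    ∃ c : ℕ → ℝ, ∀ y, s y = ∑ i ∈ Finset.Icc 1 (m + D.K), c i * N i y := by
  let v : Finset.Icc 1 (m + D.K) → D.splineSubmodule := fun i => ⟨N i, hN.mem i i.2⟩
  let ext (g : Finset.Icc 1 (m + D.K) → ℝ) (n : ℕ) : ℝ :=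
    if h : n ∈ Finset.Icc 1 (m + D.K) then g ⟨n, h⟩ else 0
  have hext : ∀ g (i : Finset.Icc 1 (m + D.K)), ext g i = g i := fun g i => dif_pos i.2
  have key : ∀ g y, (∑ i, g i • v i : D.splineSubmodule).1 y =
      ∑ i ∈ Finset.Icc 1 (m + D.K), ext g i * N i y := by
    intro g y
    rw [← Finset.sum_coe_sort (Finset.Icc 1 (m + D.K)) (fun i => ext g i * N i y)]
    simp [hext, v]
  have hli : LinearIndependent ℝ v := by
    rw [Fintype.linearIndependent_iff]
    intro g hg i
    rw [← hext g i]
    refine hN.coeff_eq_zero ht (fun y => ?_) i i.2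
    rw [← key, hg]
    rfl
  -- `m + K` independent elements in a space of dimension at most `m + K`.
  have hcard : Fintype.card (Finset.Icc 1 (m + D.K)) = Module.finrank ℝ D.splineSubmodule := by
    refine le_antisymm hli.fintype_card_le_finrank (D.finrank_splineSubmodule_le.trans ?_)
    simp
  have hmem : (⟨s, hs⟩ : D.splineSubmodule) ∈ Submodule.span ℝ (Set.range v) := by
    rw [hli.span_eq_top_of_card_eq_finrank' hcard]
    trivial
  obtain ⟨g, hg⟩ := (Submodule.mem_span_range_iff_exists_fun ℝ).1 hmem
  refine ⟨ext g, fun y => ?_⟩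
  rw [← key, hg]

end IsBSplineBasis

end Data

end PCSpline

namespace PCSpline

open Set Filter Topology

namespace Data

variable {m : ℕ} {D D' : Data m} {t t' : ℕ → ℝ} {ℓ : ℕ} {τ : ℝ}

/-! ### Knots and multiplicities under knot insertion. -/

namespace IsKnotInsertion

theorem m_le (h : D.IsKnotInsertion D' t t' ℓ τ) : m ≤ ℓ := by
  by_contra! hl
  have h1 := h.part.2.1 ℓ (Finset.mem_Icc.2 ⟨h.one_le, hl.le⟩)
  have h2 := h.part.2.1 (ℓ + 1) (Finset.mem_Icc.2 ⟨by omega, hl⟩)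
  have := h.le_τ.trans_lt h.τ_lt
  rw [h1, h2] at this
  exact this.false

theorem le_m_add (h : D.IsKnotInsertion D' t t' ℓ τ) : ℓ ≤ m + D.K := by
  by_contra! hl
  have hc := h.lt_card
  have h1 := h.part.2.2.1 ℓ (Finset.mem_Icc.2 ⟨hl, by omega⟩)
  have h2 := h.part.2.2.1 (ℓ + 1) (Finset.mem_Icc.2 ⟨by omega, hc⟩)
  have := h.le_τ.trans_lt h.τ_lt
  rw [h1, h2] at this
  exact this.false

theorem a_eq (h : D.IsKnotInsertion D' t t' ℓ τ) : D'.a = D.a := by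
  have hm := D.m_pos
  rw [← h.part.2.1 1 (Finset.mem_Icc.2 ⟨le_rfl, hm⟩),
    ← h.part'.2.1 1 (Finset.mem_Icc.2 ⟨le_rfl, hm⟩),
    h.before 1 (Finset.mem_Icc.2 ⟨le_rfl, h.one_le⟩)]

theorem b_eq (h : D.IsKnotInsertion D' t t' ℓ τ) : D'.b = D.b := by
  have hm := D.m_pos
  have hK := h.card_eq
  rw [← h.part.2.2.1 (2 * m + D.K) (Finset.mem_Icc.2 ⟨by omega, le_rfl⟩),
    ← h.part'.2.2.1 (2 * m + D.K + 1) (Finset.mem_Icc.2 ⟨by omega, by omega⟩),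
    h.after _ (Finset.mem_Icc.2 ⟨h.lt_card, le_rfl⟩)]

theorem before_eq (h : D.IsKnotInsertion D' t t' ℓ τ) {i : ℕ} (h1 : 1 ≤ i) (h2 : i ≤ ℓ) :
    t' i = t i := h.before i (Finset.mem_Icc.2 ⟨h1, h2⟩)

theorem after_eq (h : D.IsKnotInsertion D' t t' ℓ τ) {i : ℕ} (h1 : ℓ < i)
    (h2 : i ≤ 2 * m + D.K) : t' (i + 1) = t i := h.after i (Finset.mem_Icc.2 ⟨h1, h2⟩)

theorem mono' (h : D.IsKnotInsertion D' t t' ℓ τ) {i j : ℕ} (hi : 1 ≤ i) (hij : i ≤ j)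
    (hj : j ≤ 2 * m + D.K + 1) : t' i ≤ t' j :=
  h.part'.mono hi hij (by have := h.card_eq; omega)

/-- With `r` the new multiplicity, the copies of `τ` in `t'` have the indices `ℓ + 2 - r, …, ℓ + 1`,
because `τ < t (ℓ + 1) = t' (ℓ + 2)`. This lemma and the next one locate the start of that run by
counting. -/
theorem lt_of_add_knotMult_le (h : D.IsKnotInsertion D' t t' ℓ τ) {i : ℕ} (h1 : 1 ≤ i)
    (h2 : i + D'.knotMult t' τ ≤ ℓ + 1) : t' i < τ := by
  have hc := h.lt_card
  have hK := h.card_eq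
  refine lt_of_le_of_ne (h.at_τ ▸ h.mono' h1 (by omega) (by omega)) fun e => ?_
  have hsub : Finset.Icc i (ℓ + 1) ⊆ (Finset.Icc 1 (2 * m + D'.K)).filter (τ = t' ·) := by
    intro j hj
    rw [Finset.mem_Icc] at hj
    rw [Finset.mem_filter, Finset.mem_Icc]
    exact ⟨by omega, le_antisymm (e ▸ h.mono' h1 hj.1 (by omega))
      (h.at_τ ▸ h.mono' (by omega) hj.2 (by omega))⟩
  have := Finset.card_le_card hsub
  rw [Nat.card_Icc] at this
  rw [knotMult, Multiset.count_map] at h2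
  change i + Finset.card ((Finset.Icc 1 (2 * m + D'.K)).filter (τ = t' ·)) ≤ _ at h2
  omega

theorem eq_of_le_add_knotMult (h : D.IsKnotInsertion D' t t' ℓ τ) {i : ℕ} (h1 : 1 ≤ i)
    (h2 : ℓ + 2 ≤ i + D'.knotMult t' τ) (h3 : i ≤ ℓ + 1) : t' i = τ := by
  have hc := h.lt_card
  have hK := h.card_eq
  by_contra hne
  have hlt : t' i < τ := lt_of_le_of_ne (h.at_τ ▸ h.mono' h1 h3 (by omega)) hne
  have hsub : (Finset.Icc 1 (2 * m + D'.K)).filter (τ = t' ·) ⊆ Finset.Icc (i + 1) (ℓ + 1) := by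
    intro j hj
    rw [Finset.mem_filter, Finset.mem_Icc] at hj
    rw [Finset.mem_Icc]
    constructor
    · by_contra! hji
      exact ((h.mono' hj.1.1 (by omega : j ≤ i) (by omega)).trans_lt hlt).ne' hj.2
    · by_contra! hji
      have h4 := h.mono' (by omega) (by omega : ℓ + 1 + 1 ≤ j) (by omega)
      rw [h.after_eq (lt_add_one ℓ) hc] at h4
      exact (h.τ_lt.trans_le h4).ne hj.2
  have := Finset.card_le_card hsub
  rw [Nat.card_Icc] at this
  rw [knotMult, Multiset.count_map] at h2
  change _ ≤ i + Finset.card ((Finset.Icc 1 (2 * m + D'.K)).filter (τ = t' ·)) at h2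
  omega

theorem knot_le (h : D.IsKnotInsertion D' t t' ℓ τ) {i j : ℕ} (hj : 1 ≤ j) (hji : j ≤ i)
    (hi : i ≤ 2 * m + D.K) : t' j ≤ t i := by
  rcases le_or_gt i ℓ with hl | hl
  · exact h.before_eq (hj.trans hji) hl ▸ h.mono' hj hji (by omega)
  · exact h.after_eq hl hi ▸ h.mono' hj (by omega) (by omega)

theorem le_knot (h : D.IsKnotInsertion D' t t' ℓ τ) {i j : ℕ} (hi : 1 ≤ i) (hij : i < j)
    (hj : j ≤ 2 * m + D.K + 1) : t i ≤ t' j := by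
  rcases le_or_gt i ℓ with hl | hl
  · exact h.before_eq hi hl ▸ h.mono' hi hij.le hj
  · exact h.after_eq hl (by omega) ▸ h.mono' (by omega) hij hj

/-- If the old run ends beyond `ℓ`, its end moves up by one in `t'`. Otherwise the extra copy comes
from starting earlier, `j < i`, or from `τ` itself at index `ℓ + 1`. -/
theorem muR_lt_muR (h : D.IsKnotInsertion D' t t' ℓ τ) {i j : ℕ} (hj : 1 ≤ j) (hji : j ≤ i)
    (hi : i ≤ 2 * m + D.K) (hr : j < i ∨ ℓ + 2 ≤ j + D'.knotMult t' τ) (e : t' j = t i) :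
    D.muR t i < D'.muR t' j := by
  have hK := h.card_eq
  have hc := h.lt_card
  obtain ⟨k, h1, h2, h3, h4⟩ := exists_muR_eq (D := D) (t := t) hi
  rcases le_or_gt k ℓ with hl | hl
  · rcases hr with hr | hr
    · have := le_muR (D := D') (t := t') (i := j) (e := k) (by omega) (by omega)
        (by rw [h.before_eq (by omega) hl, h3, e])
      omega
    · have := le_muR (D := D') (t := t') (i := j) (e := ℓ + 1) (by omega) (by omega)
        (by rw [h.at_τ, h.eq_of_le_add_knotMult hj hr (by omega)])
      omega
  · have := le_muR (D := D') (t := t') (i := j) (e := k + 1) (by omega) (by omega)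
      (by rw [h.after_eq hl h2, h3, e])
    omega

theorem muL_lt_muL (h : D.IsKnotInsertion D' t t' ℓ τ) {i j : ℕ} (hi : 1 ≤ i) (hij : i < j)
    (hr : i + 1 < j ∨ i ≤ ℓ) (hj : j ≤ 2 * m + D.K + 1) (e : t' j = t i) :
    D.muL t i < D'.muL t' j := by
  obtain ⟨k, h1, h2, h3, h4⟩ := exists_muL_eq (D := D) (t := t) hi
  rcases le_or_gt k ℓ with hl | hl
  · have := le_muL (D := D') (t := t') (i := j) (e := k) (by omega) (by omega)
      (by rw [h.before_eq (by omega) hl, h3, e])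
    omega
  · have := le_muL (D := D') (t := t') (i := j) (e := k + 1) (by omega) (by omega)
      (by rw [h.after_eq hl (by omega), h3, e])
    omega

/-- A run strictly below `τ` stays within the indices up to `ℓ`, where both partitions agree. -/
theorem muR_eq (h : D.IsKnotInsertion D' t t' ℓ τ) {i : ℕ} (h1 : 1 ≤ i) (hl : i ≤ ℓ)
    (hi : t' i < τ) : D'.muR t' i = D.muR t i := by
  have hK := h.card_eq
  have hc := h.lt_card
  have hti := h.before_eq h1 hl
  apply le_antisymm
  · obtain ⟨k, h2, h3, h4, h5⟩ := exists_muR_eq (D := D') (t := t') (i := i) (by omega)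
    have hk : k ≤ ℓ := by
      by_contra! hk
      have := h.mono' (by omega) hk (by omega)
      rw [h.at_τ, h4] at this
      exact hi.not_ge this
    rw [h5]
    exact le_muR h2 (by omega) (by rw [← h.before_eq (by omega) hk, h4, hti])
  · obtain ⟨k, h2, h3, h4, h5⟩ := exists_muR_eq (D := D) (t := t) (i := i) (by omega)
    have hk : k ≤ ℓ := by
      by_contra! hk
      have := h.part.mono (by omega) hk h3
      rw [h4, ← hti] at this
      exact (hi.trans h.τ_lt).not_ge this
    rw [h5]
    exact le_muR h2 (by omega) (by rw [h.before_eq (by omega) hk, h4, hti])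

/-! ### Old B-splines in terms of new ones. -/

section Refinement

variable {N N' : ℕ → ℝ → ℝ} {i : ℕ} {g : ℕ → ℝ}

/-- At each `t' k` with `k ≤ n`, `N i` vanishes beyond the leading order of `N' k`, so forward
substitution applies. The choice `n = i - 1` gives triangularity; `n = i` kills the diagonal entry
from the first copy of `τ` on. -/
theorem coeff_eq_zero_of_le (h : D.IsKnotInsertion D' t t' ℓ τ) (hN : D.IsBSplineBasis t N)
    (hN' : D'.IsBSplineBasis t' N') (hi : i ∈ Finset.Icc 1 (m + D.K))
    (hg : ∀ y, N i y = ∑ j ∈ Finset.Icc 1 (m + D'.K), g j * N' j y) {n : ℕ} (hn : n ≤ i)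
    (hr : n < i ∨ ℓ + 2 ≤ n + D'.knotMult t' τ) {j : ℕ} (hj : 1 ≤ j) (hjn : j ≤ n) :
    g j = 0 := by
  have hK := h.card_eq
  have hi' := Finset.mem_Icc.1 hi
  refine hN'.coeff_eq_zero_of_rightDeriv h.part' hg (n := n + 1) (fun k hk hkn => ?_) j
    (Finset.mem_Icc.2 ⟨hj, by omega⟩) (by omega)
  have hk' := Finset.mem_Icc.1 hk
  refine hN.rightDeriv_eq_zero hi (h.knot_le hk'.1 (by omega) (by omega)) fun e => ?_
  have h1 := h.muR_lt_muR (i := i) hk'.1 (by omega) (by omega) (by omega) e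
  have h2 := h.part'.muR_le hk'.1 hk'.2
  omega

/-- The mirror image from the right. The choice `n = i + 2` bounds the band; `n = i + 1` kills the
off-diagonal entry when the last knot of `N i` has index at most `ℓ`. -/
theorem coeff_eq_zero_of_ge (h : D.IsKnotInsertion D' t t' ℓ τ) (hN : D.IsBSplineBasis t N)
    (hN' : D'.IsBSplineBasis t' N') (hi : i ∈ Finset.Icc 1 (m + D.K))
    (hg : ∀ y, N i y = ∑ j ∈ Finset.Icc 1 (m + D'.K), g j * N' j y) {n : ℕ} (hn : i < n)
    (hr : i + 1 < n ∨ i + m ≤ ℓ) {j : ℕ} (hj : j ≤ m + D.K + 1) (hjn : n ≤ j) :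
    g j = 0 := by
  have hK := h.card_eq
  have hi' := Finset.mem_Icc.1 hi
  refine hN'.coeff_eq_zero_of_leftDeriv h.part' hg (n := n - 1) (fun k hk hkn => ?_) j
    (Finset.mem_Icc.2 ⟨by omega, by omega⟩) (by omega)
  have hk' := Finset.mem_Icc.1 hk
  refine hN.leftDeriv_eq_zero hi (h.le_knot (by omega) (by omega) (by omega)) fun e => ?_
  have h1 := h.muL_lt_muL (i := i + m) (j := k + m) (by omega) (by omega) (by omega) (by omega) e
  have h2 := h.part'.muL_le hk'.1 hk'.2
  omega

theorem rightDeriv_transition_eq_and_ne_zero (h : D.IsKnotInsertion D' t t' ℓ τ)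
    (hN' : D'.IsBSplineBasis t' N') (h1 : 1 ≤ i) (hl : i ≤ ℓ) (hi : t' i < τ) :
    rightDeriv (m - D.muR t i) (D'.transition N' i) (t i) =
      rightDeriv (m - D.muR t i) (N' i) (t i) ∧
    rightDeriv (m - D.muR t i) (N' i) (t i) ≠ 0 := by
  have hK := h.card_eq
  have hlm := h.le_m_add
  rw [← h.muR_eq h1 hl hi, ← h.before_eq h1 hl]
  refine ⟨?_, (hN'.left_end i (Finset.mem_Icc.2 ⟨h1, by omega⟩)).2⟩
  have := hN'.rightDeriv_sum h.part' (A := Finset.Icc i (m + D'.K)) (j := i) (c := fun _ => 1)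
    (Finset.Icc_subset_Icc_left h1) (Finset.mem_Icc.2 ⟨le_rfl, by omega⟩)
    fun k hk hki => absurd (Finset.mem_Icc.1 hk).1 hki.not_ge
  simp only [one_mul] at this
  exact this

/-- At `t i` only the first B-spline of each transition function contributes to the leading
derivative, and there `N i` behaves like `g i` times `N' i`. -/
theorem alpha_eq (h : D.IsKnotInsertion D' t t' ℓ τ) (hN : D.IsBSplineBasis t N)
    (hN' : D'.IsBSplineBasis t' N') (h1 : 1 ≤ i) (hl : i ≤ ℓ) (hi : t' i < τ)
    (hg : ∀ y, N i y = ∑ j ∈ Finset.Icc 1 (m + D'.K), g j * N' j y)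
    (hg0 : ∀ j, 1 ≤ j → j < i → g j = 0) : D.alpha D' t N N' i = g i := by
  have hK := h.card_eq
  have hlm := h.le_m_add
  obtain ⟨e1, e2⟩ := h.rightDeriv_transition_eq_and_ne_zero hN' h1 hl hi
  have e3 := hN.rightDeriv_sum h.part (A := Finset.Icc i (m + D.K)) (j := i) (c := fun _ => 1)
    (Finset.Icc_subset_Icc_left h1) (Finset.mem_Icc.2 ⟨le_rfl, by omega⟩)
    fun k hk hki => absurd (Finset.mem_Icc.1 hk).1 hki.not_ge
  have e4 := hN'.rightDeriv_sum h.part' (A := Finset.Icc 1 (m + D'.K)) (j := i) (c := g)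
    subset_rfl (Finset.mem_Icc.2 ⟨h1, by omega⟩)
    fun k hk hki => hg0 k (Finset.mem_Icc.1 hk).1 hki
  rw [← funext hg, h.muR_eq h1 hl hi, h.before_eq h1 hl] at e4
  have e5 : rightDeriv (m - D.muR t i) (D.transition N i) (t i) =
      g i * rightDeriv (m - D.muR t i) (N' i) (t i) := by
    rw [← e4]
    simp only [one_mul] at e3
    exact e3
  rw [alpha, e5, e1, mul_div_assoc, div_self e2, mul_one]

/-- The old B-splines are combinations of the new ones, with coefficients extended by zero. -/
theorem exists_refinement (h : D.IsKnotInsertion D' t t' ℓ τ) (hN : D.IsBSplineBasis t N)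
    (hN' : D'.IsBSplineBasis t' N') (hsub : D.splineSpace ⊆ D'.splineSpace) :
    ∃ G : ℕ → ℕ → ℝ,
      (∀ i ∈ Finset.Icc 1 (m + D.K), ∀ y,
        N i y = ∑ j ∈ Finset.Icc 1 (m + D'.K), G i j * N' j y) ∧
      (∀ i ∉ Finset.Icc 1 (m + D.K), ∀ j, G i j = 0) := by
  have hex : ∀ i, ∃ g : ℕ → ℝ,
      (i ∈ Finset.Icc 1 (m + D.K) → ∀ y,
        N i y = ∑ j ∈ Finset.Icc 1 (m + D'.K), g j * N' j y) ∧
      (i ∉ Finset.Icc 1 (m + D.K) → ∀ j, g j = 0) := by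
    intro i
    by_cases hi : i ∈ Finset.Icc 1 (m + D.K)
    · obtain ⟨g, hg⟩ := hN'.exists_coeff h.part' (hsub (hN.mem i hi))
      exact ⟨g, fun _ => hg, fun hi' => absurd hi hi'⟩
    · exact ⟨0, fun hi' => absurd hi' hi, fun _ _ => rfl⟩
  choose G hG using hex
  exact ⟨G, fun i => (hG i).1, fun i => (hG i).2⟩

end Refinement

end IsKnotInsertion

/-- The action of a bidiagonal matrix with rows `1, …, M`. -/
theorem sum_mul_bidiagonal {M : ℕ} {G : ℕ → ℕ → ℝ} (hG : ∀ i ∉ Finset.Icc 1 M, ∀ j, G i j = 0)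
    {j : ℕ} (hj : j ∈ Finset.Icc 1 (M + 1))
    (hband : ∀ i ∈ Finset.Icc 1 M, i ≠ j → i ≠ j - 1 → G i j = 0) (c : ℕ → ℝ) :
    ∑ i ∈ Finset.Icc 1 M, c i * G i j = c j * G j j + c (j - 1) * G (j - 1) j := by
  have hj' := Finset.mem_Icc.1 hj
  -- The pair may contain `0` or `M + 1`, outside the range of summation. Both sums are therefore
  -- enlarged to the union, where the zero rows of `G` add nothing.
  rw [← Finset.sum_pair (f := fun i => c i * G i j) (by omega : j ≠ j - 1),
    Finset.sum_subset (Finset.subset_union_left (s₂ := {j, j - 1})),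
    Finset.sum_subset (Finset.subset_union_right (s₁ := Finset.Icc 1 M) (s₂ := {j, j - 1}))]
  · intro i _ hi
    simp only [Finset.mem_insert, Finset.mem_singleton, not_or] at hi
    by_cases hiM : i ∈ Finset.Icc 1 M
    · rw [hband i hiM hi.1 hi.2, mul_zero]
    · rw [hG i hiM, mul_zero]
  · intro i _ hi
    rw [hG i hi, mul_zero]

end Data

end PCSpline

/-! ### The knot insertion formula. -/

/-- As `c'` is arbitrary, the equivalence contains both halves: left to right is uniqueness, right
to left is existence. Index ranges are written additively to avoid truncated subtraction. -/
theorem mainTheorem2 (m : ℕ) (D D' : PCSpline.Data m) (t t' : ℕ → ℝ) (ℓ : ℕ) (τ : ℝ)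
    (hins : D.IsKnotInsertion D' t t' ℓ τ)
    (r : ℕ) (hr : r = D'.knotMult t' τ) (hr1 : 1 ≤ r) (hrm : r < m)
    (hsub : D.splineSpace ⊆ D'.splineSpace)
    (N N' : ℕ → ℝ → ℝ) (hN : D.IsBSplineBasis t N) (hN' : D'.IsBSplineBasis t' N') :
    (∀ i ∈ Finset.Icc 1 (m + D.K + 1), ℓ + 2 ≤ i + m → i + r ≤ ℓ + 1 →
      PCSpline.rightDeriv (m - D.muR t i) (D'.transition N' i) (t i) ≠ 0) ∧
    ∀ (s : ℝ → ℝ) (c c' : ℕ → ℝ),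
      (∀ y ∈ Set.Icc D.a D.b, s y = ∑ i ∈ Finset.Icc 1 (m + D.K), c i * N i y) →
      ((∀ y ∈ Set.Icc D.a D.b, s y = ∑ i ∈ Finset.Icc 1 (m + D.K + 1), c' i * N' i y) ↔
        ∀ i ∈ Finset.Icc 1 (m + D.K + 1),
          (i + m ≤ ℓ + 1 → c' i = c i) ∧
          (ℓ + 2 ≤ i + m → i + r ≤ ℓ + 1 →
            c' i = D.alpha D' t N N' i * c i + (1 - D.alpha D' t N N' i) * c (i - 1)) ∧
          (ℓ + 2 ≤ i + r → c' i = c (i - 1))) := by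
  subst hr
  have hml := hins.m_le
  have hlm := hins.le_m_add
  have hK : m + D'.K = m + D.K + 1 := by rw [hins.card_eq, add_assoc]
  constructor
  · intro i hi _ h2
    have h1 := (Finset.mem_Icc.1 hi).1
    obtain ⟨e1, e2⟩ := hins.rightDeriv_transition_eq_and_ne_zero hN' h1 (by omega)
      (hins.lt_of_add_knotMult_le h1 h2)
    rwa [e1]
  intro s c c' hs
  obtain ⟨G, hG, hG0⟩ := hins.exists_refinement hN hN' hsub
  have hlow : ∀ i ∈ Finset.Icc 1 (m + D.K), ∀ j, 1 ≤ j → j < i → G i j = 0 := fun i hi j hj hji =>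
    hins.coeff_eq_zero_of_le hN hN' hi (hG i hi) (n := i - 1) (by omega) (by omega) hj (by omega)
  have hsum : ∀ d : ℕ → ℝ, ∀ y, ∑ i ∈ Finset.Icc 1 (m + D.K), d i * N i y =
      ∑ j ∈ Finset.Icc 1 (m + D'.K), (d j * G j j + d (j - 1) * G (j - 1) j) * N' j y := by
    intro d y
    calc ∑ i ∈ Finset.Icc 1 (m + D.K), d i * N i y
        = ∑ i ∈ Finset.Icc 1 (m + D.K), ∑ j ∈ Finset.Icc 1 (m + D'.K),
            d i * G i j * N' j y := by
          refine Finset.sum_congr rfl fun i hi => ?_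
          rw [hG i hi, Finset.mul_sum]
          simp only [mul_assoc]
      _ = ∑ j ∈ Finset.Icc 1 (m + D'.K), (∑ i ∈ Finset.Icc 1 (m + D.K), d i * G i j) *
            N' j y := by
          rw [Finset.sum_comm]
          simp only [Finset.sum_mul]
      _ = _ := by
          refine Finset.sum_congr rfl fun j hj => ?_
          have hj' := Finset.mem_Icc.1 hj
          rw [PCSpline.Data.sum_mul_bidiagonal hG0 (hK ▸ hj) fun i hi h1 h2 => ?_]
          rcases lt_or_gt_of_ne h1 with h | h
          · exact hins.coeff_eq_zero_of_ge hN hN' hi (hG i hi) (n := i + 2) (by omega) (by omega)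
              (by omega) (by omega)
          · exact hlow i hi j hj'.1 h
  -- The constant `1` has all coefficients `1` in both bases; at the extreme indices the missing
  -- entry is a zero row of `G`.
  have hone : ∀ j ∈ Finset.Icc 1 (m + D'.K), G j j + G (j - 1) j = 1 := by
    refine (hN'.sum_eq_sum_iff hins.part').1 fun y hy => ?_
    have h1 := hsum (fun _ => 1) y
    simp only [one_mul] at h1 ⊢
    rw [← h1, hN'.sum_eq_one y hy]
    exact hN.sum_eq_one y (by rwa [← hins.a_eq, ← hins.b_eq])
  have hcoef : (∀ y ∈ Set.Icc D.a D.b,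
      s y = ∑ i ∈ Finset.Icc 1 (m + D.K + 1), c' i * N' i y) ↔
      ∀ j ∈ Finset.Icc 1 (m + D.K + 1), c' j = c j * G j j + c (j - 1) * G (j - 1) j := by
    rw [← hK, ← hN'.sum_eq_sum_iff hins.part', hins.a_eq, hins.b_eq]
    refine forall₂_congr fun y hy => ?_
    rw [hs y hy, hsum, eq_comm]
  rw [hcoef]
  refine forall₂_congr fun j hj => ?_
  have hj' := Finset.mem_Icc.1 hj
  have h1 := hone j (hK ▸ hj)
  -- Since `r < m`, the three index ranges are disjoint, and in each case the other two clauses hold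
  -- vacuously.
  rcases le_or_gt (j + m) (ℓ + 1) with ha | ha
  · have h0 : G (j - 1) j = 0 := by
      by_cases hj1 : j - 1 ∈ Finset.Icc 1 (m + D.K)
      · exact hins.coeff_eq_zero_of_ge hN hN' hj1 (hG _ hj1) (n := j) (by omega) (by omega)
          hj'.2 le_rfl
      · exact hG0 _ hj1 j
    have h2 : G j j = 1 := by linarith
    rw [h0, h2, mul_one, mul_zero, add_zero]
    exact ⟨fun h => ⟨fun _ => h, fun _ _ => by omega, fun _ => by omega⟩, fun h => h.1 ha⟩
  rcases le_or_gt (j + D'.knotMult t' τ) (ℓ + 1) with hb | hb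
  · have hjM : j ∈ Finset.Icc 1 (m + D.K) := Finset.mem_Icc.2 ⟨hj'.1, by omega⟩
    have h2 : D.alpha D' t N N' j = G j j :=
      hins.alpha_eq hN hN' hj'.1 (by omega) (hins.lt_of_add_knotMult_le hj'.1 hb) (hG j hjM)
        (hlow j hjM)
    have h3 : G (j - 1) j = 1 - G j j := by linarith
    rw [h2, h3, mul_comm (c j), mul_comm (c (j - 1))]
    exact ⟨fun h => ⟨fun _ => by omega, fun _ _ => h, fun _ => by omega⟩,
      fun h => h.2.1 ha hb⟩
  · have h0 : G j j = 0 := by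
      by_cases hjM : j ∈ Finset.Icc 1 (m + D.K)
      · exact hins.coeff_eq_zero_of_le hN hN' hjM (hG _ hjM) (n := j) le_rfl (Or.inr hb)
          hj'.1 le_rfl
      · exact hG0 _ hjM j
    have h2 : G (j - 1) j = 1 := by linarith
    rw [h0, h2, mul_one, mul_zero, zero_add]
    exact ⟨fun h => ⟨fun _ => by omega, fun _ _ => by omega, fun _ => h⟩, fun h => h.2.2 hb⟩
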